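/- Let $\mathbb{H}$ be the quaternions with units $i,j,k$. For $\varphi,f\in L^2(\mathbb{R}^2,\mathbb{H})$, the two-sided Gabor quaternion Fourier transform (GQFT) of $f$ with window $\varphi$ is $$\mathcal{G}_\varphi f(\omega,b)=\int_{\mathbb{R}^2}e^{-2\pi i x_1\omega_1}\,f(x)\,\overline{\varphi(x-b)}\,e^{-2\pi j x_2\omega_2}\,dx,\qquad (\omega,b)\in\mathbb{R}^2\times\mathbb{R}^2 .$$ The space $L^2(\mathbb{R}^2\times\mathbb{R}^2,\mathbb{H})$ is regarded as a real Hilbert space. For $\varphi\neq 0$, $P_\varphi$ denotes the orthogonal projection of it onto the (closed, real-linear) image $\{\mathcal{G}_\varphi f: f\in L^2(\mathbb{R}^2,\mathbb{H})\}$, and for a Lebesgue measurable set $\Sigma\subseteq\mathbb{R}^2\times\mathbb{R}^2$, $P_\Sigma F=\chi_\Sigma F$. The set $\Sigma$ is called weakly annihilating (for $\varphi$) if every $f\in L^2(\mathbb{R}^2,\mathbb{H})$ whose transform $\mathcal{G}_\varphi f$ is supported in $\Sigma$, i.e. vanishes almost everywhere outside $\Sigma$, is zero. **Theorem (Benedicks-type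 theorem for the GQFT).** Let $r,R>0$ and write $B_\rho=\{x\in\mathbb{R}^2:|x|<\rho\}$. Let $\varphi\in L^2(\mathbb{R}^2,\mathbb{H})\cap L^\infty(\mathbb{R}^2,\mathbb{H})$ be a nonzero window that vanishes almost everywhere outside $B_r$. Let $S\subseteq\mathbb{R}^2$ be such that $\Sigma=S\times B_R$ (with $\omega\in S$, $b\in B_R$) is Lebesgue measurable with measure $0<m(\Sigma)<\infty$. Then $$\operatorname{Im}P_\varphi\cap\operatorname{Im}P_\Sigma=\{0\},$$ and $\Sigma$ is weakly annihilating for $\varphi$. -/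

import Mathlib

open MeasureTheory

noncomputable section

/-- The plane `ℝ²` with its Euclidean norm and Lebesgue measure. -/
abbrev Plane : Type := EuclideanSpace ℝ (Fin 2)

/-- The Hamilton quaternions. -/
abbrev Quat : Type := Quaternion ℝ

/-- `L²(ℝ², ℍ)`, a real Hilbert space. -/
abbrev L2Plane : Type := Lp Quat 2 (volume : Measure Plane)

/-- `L²(ℝ² × ℝ², ℍ)`, a real Hilbert space. -/
abbrev L2Phase : Type := Lp Quat 2 (volume : Measure (Plane × Plane))

/-- The quaternion unit `i`. -/
def quatI : Quat := ⟨0, 1, 0, 0⟩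

/-- The quaternion unit `j`. -/
def quatJ : Quat := ⟨0, 0, 1, 0⟩

/-- The exponential `e^{i t}`. -/
def expI (t : ℝ) : Quat := NormedSpace.exp (t • quatI)

/-- The exponential `e^{j t}`. -/
def expJ (t : ℝ) : Quat := NormedSpace.exp (t • quatJ)

/-- The Gabor quaternion Fourier transform (GQFT) of `f` with window `φ`:
`∫ e^{-2π i x₁ ω₁} f(x) \overline{φ(x - b)} e^{-2π j x₂ ω₂} dx`. -/
def gqft (φ f : Plane → Quat) (ω b : Plane) : Quat :=
  ∫ x : Plane, expI (-(2 * Real.pi * (x 0 * ω 0))) * (f x * star (φ (x - b))) *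
    expJ (-(2 * Real.pi * (x 1 * ω 1)))

theorem norm_expI (t : ℝ) : ‖expI t‖ = 1 := by
  have h : (t • quatI).re = 0 := by rw [Quaternion.re_smul]; exact smul_zero t
  rw [expI, Quaternion.norm_exp, h, NormedSpace.exp_zero, norm_one]

theorem norm_expJ (t : ℝ) : ‖expJ t‖ = 1 := by
  have h : (t • quatJ).re = 0 := by rw [Quaternion.re_smul]; exact smul_zero t
  rw [expJ, Quaternion.norm_exp, h, NormedSpace.exp_zero, norm_one]

theorem continuous_expI : Continuous expI := by
  let _ : NormedAlgebra ℚ Quat := NormedAlgebra.restrictScalars ℚ ℝ Quat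
  exact NormedSpace.exp_continuous.comp (continuous_id.smul continuous_const)

theorem continuous_expJ : Continuous expJ := by
  let _ : NormedAlgebra ℚ Quat := NormedAlgebra.restrictScalars ℚ ℝ Quat
  exact NormedSpace.exp_continuous.comp (continuous_id.smul continuous_const)

/-- The integrand of the GQFT of `L²` data is integrable for every `(ω, b)`. -/
theorem integrable_gqft (φ f : L2Plane) (ω b : Plane) :
    Integrable (fun x : Plane => expI (-(2 * Real.pi * (x 0 * ω 0))) *
      (f x * star (φ (x - b))) * expJ (-(2 * Real.pi * (x 1 * ω 1)))) volume := by
  have hφ : MemLp (fun x : Plane => star (φ (x - b))) 2 volume :=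
    ((Lp.memLp φ).comp_measurePreserving (measurePreserving_sub_right volume b)).star
  have h : Integrable (fun x : Plane => f x * star (φ (x - b))) volume :=
    (Lp.memLp f).integrable_mul hφ
  have hI : Continuous fun x : Plane => expI (-(2 * Real.pi * (x 0 * ω 0))) :=
    continuous_expI.comp (by fun_prop)
  have hJ : Continuous fun x : Plane => expJ (-(2 * Real.pi * (x 1 * ω 1))) :=
    continuous_expJ.comp (by fun_prop)
  refine h.mono ((hI.aestronglyMeasurable.mul h.1).mul hJ.aestronglyMeasurable) ?_
  exact Filter.Eventually.of_forall fun x => by simp [norm_expI, norm_expJ]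

theorem gqft_congr {φ f g : Plane → Quat} (h : f =ᵐ[volume] g) (ω b : Plane) :
    gqft φ f ω b = gqft φ g ω b :=
  integral_congr_ae (h.mono fun x hx => by simp only [hx])

theorem gqft_add (φ f g : L2Plane) (ω b : Plane) :
    gqft φ (f + g : L2Plane) ω b = gqft φ f ω b + gqft φ g ω b := by
  rw [gqft_congr (Lp.coeFn_add f g) ω b]
  unfold gqft
  rw [← integral_add (integrable_gqft φ f ω b) (integrable_gqft φ g ω b)]
  congr 1
  ext1 x
  simp only [Pi.add_apply]
  noncomm_ring

theorem gqft_smul (φ : L2Plane) (c : ℝ) (f : L2Plane) (ω b : Plane) :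
    gqft φ (c • f : L2Plane) ω b = c • gqft φ f ω b := by
  rw [gqft_congr (Lp.coeFn_smul c f) ω b]
  unfold gqft
  rw [← integral_smul]
  congr 1
  ext1 x
  simp only [Pi.smul_apply, smul_mul_assoc, mul_smul_comm]

/-- The real subspace of `L²(ℝ² × ℝ², ℍ)` formed by the transforms `(ω, b) ↦ gqft φ f ω b`,
`f ∈ L²(ℝ², ℍ)`. -/
def gqftImage (φ : L2Plane) : Submodule ℝ L2Phase where
  carrier := {F | ∃ f : L2Plane, ∀ᵐ p : Plane × Plane, F p = gqft φ f p.1 p.2}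
  zero_mem' := by
    refine ⟨0, ?_⟩
    filter_upwards [Lp.coeFn_zero Quat 2 (volume : Measure (Plane × Plane))] with p hp
    have h := gqft_smul φ 0 0 p.1 p.2
    rw [zero_smul, zero_smul] at h
    rw [hp, h, Pi.zero_apply]
  add_mem' := by
    rintro F G ⟨f, hf⟩ ⟨g, hg⟩
    refine ⟨f + g, ?_⟩
    filter_upwards [Lp.coeFn_add F G, hf, hg] with p hp h1 h2
    rw [hp, Pi.add_apply, h1, h2, gqft_add]
  smul_mem' := by
    rintro c F ⟨f, hf⟩
    refine ⟨c • f, ?_⟩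
    filter_upwards [Lp.coeFn_smul c F, hf] with p hp h1
    rw [hp, Pi.smul_apply, h1, gqft_smul]

/-- `P_φ`: the orthogonal projection of `L²(ℝ² × ℝ², ℍ)` onto the image of the GQFT with
window `φ`. That image is closed, because the GQFT is `‖φ‖` times a real-linear isometry, so
taking the closure does not change it; it is written here only because an orthogonal projection
is defined for closed subspaces. -/
def projWindow (φ : L2Plane) : L2Phase →L[ℝ] L2Phase :=
  (gqftImage φ).topologicalClosure.starProjection

/-- `P_Σ`: multiplication by the indicator function of the measurable set `A`, that is, the
orthogonal projection of `L²(ℝ² × ℝ², ℍ)` onto the functions that vanish a.e. outside `A`. -/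
def projSet (A : Set (Plane × Plane)) (hA : NullMeasurableSet A volume) :
    L2Phase →ₗ[ℝ] L2Phase where
  toFun F := MemLp.toLp (A.indicator F)
    ((Lp.memLp F).mono ((Lp.aestronglyMeasurable F).indicator₀ hA)
      (Filter.Eventually.of_forall fun p => norm_indicator_le_norm_self F p))
  map_add' F G := by
    rw [← MemLp.toLp_add, MemLp.toLp_eq_toLp_iff, ← Set.indicator_add']
    exact (Lp.coeFn_add F G).mono fun p hp => by simp only [Set.indicator, hp]
  map_smul' c F := by
    rw [RingHom.id_apply, ← MemLp.toLp_const_smul, MemLp.toLp_eq_toLp_iff]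
    filter_upwards [Lp.coeFn_smul c F] with p hp
    by_cases h : p ∈ A <;> simp [h, hp]

/-- `A` is weakly annihilating for the window `φ`: every `f ∈ L²(ℝ², ℍ)` whose GQFT is
supported in `A` (vanishes a.e. outside `A`) is zero. -/
def WeaklyAnnihilating (φ : L2Plane) (A : Set (Plane × Plane)) : Prop :=
  ∀ f : L2Plane, (∀ᵐ p : Plane × Plane, p ∉ A → gqft φ f p.1 p.2 = 0) → f = 0

end

/-! Fix `b`. The windowed function `x ↦ f x * star (φ (x - b))` has bounded support, so its Fourier
transform is analytic along lines. By Fubini, almost every slice `{ω | (ω, b) ∈ A}` has finite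
measure, and an analytic function vanishing off such a set is zero
(`ae_eq_zero_of_fourier_supported`). So the windowed function vanishes for a.e. `b`; integrating its
squared norm over `x` and `b` gives `‖f‖² ‖φ‖² = 0`, hence `f = 0`.

The two-sided kernel reduces to the scalar one by splitting `ℍ` into the planes `i q = -q j` and `i
q = q j`: on each the GQFT is a complex Fourier transform, once with reflected frequency
(`splitMinus_gqft`, `splitPlus_gqft`). Plancherel on both planes gives `norm_eq_of_ae_eq_gqft`,
which makes the image closed, so that elements of the range of `projWindow φ` are genuine
transforms. -/

/-! ### Plancherel on `L¹ ∩ L²` and analyticity of Fourier transforms. -/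

section FourierAnalysis

open FourierTransform SchwartzMap Complex

variable {V : Type*} [NormedAddCommGroup V] [InnerProductSpace ℝ V] [FiniteDimensional ℝ V]
  [MeasurableSpace V] [BorelSpace V]

theorem continuous_fourier_of_integrable {h : V → ℂ} (hh : Integrable h) :
    Continuous (𝓕 h) :=
  VectorFourier.fourierIntegral_continuous Real.continuous_fourierChar
    (by exact continuous_inner) hh

theorem integral_fourier_smul_eq_of_integrable {g h : V → ℂ} (hg : Integrable g)
    (hh : Integrable h) : ∫ x, 𝓕 g x • h x = ∫ x, g x • 𝓕 h x := by
  simpa using! (VectorFourier.integral_fourierIntegral_smul_eq_flip (L := innerₗ V)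
    Real.continuous_fourierChar continuous_inner hg hh)

/-- On `L¹ ∩ L²` the `L²` Fourier transform is given by the Fourier integral. -/
theorem fourier_toLp_ae_eq {h : V → ℂ} (h1 : Integrable h) (h2 : MemLp h 2) :
    (𝓕 (h2.toLp h) : Lp ℂ 2 (volume : Measure V)) =ᵐ[volume] 𝓕 h := by
  set F : Lp ℂ 2 (volume : Measure V) := 𝓕 (h2.toLp h) with hF
  have hFl : LocallyIntegrable F volume := (Lp.memLp F).locallyIntegrable (by norm_num)
  have hcl : LocallyIntegrable (𝓕 h) volume :=
    (continuous_fourier_of_integrable h1).locallyIntegrable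
  -- Both sides are locally integrable, so testing against smooth compactly supported functions
  -- suffices; there each transform moves onto the test function by duality.
  have key : ∀ᵐ x, (⇑F - 𝓕 h) x = 0 := by
    apply ae_eq_zero_of_integral_contDiff_smul_eq_zero (hFl.sub hcl)
    intro g g_smooth g_cpt
    have hg₁ : HasCompactSupport (Complex.ofRealCLM ∘ g) := g_cpt.comp_left rfl
    have hg₂ : ContDiff ℝ (↑(⊤ : ℕ∞)) (Complex.ofRealCLM ∘ g) := by fun_prop
    set G : 𝓢(V, ℂ) := hg₁.toSchwartzMap hg₂ with hG
    have hGg : ∀ x, G x = (g x : ℂ) := fun x => by simp [hG]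
    have e1 : ∫ x, G x • F x = ∫ x, (𝓕 G) x • h x := by
      have := congrArg (fun T : 𝓢'(V, ℂ) => T G)
        (Lp.fourier_toTemperedDistribution_eq (h2.toLp h))
      simp only [TemperedDistribution.fourier_apply, Lp.toTemperedDistribution_apply] at this
      rw [← hF] at this
      rw [← this]
      refine integral_congr_ae ?_
      filter_upwards [h2.coeFn_toLp] with x hx
      rw [hx]
    have e2 : ∫ x, (𝓕 G) x • h x = ∫ x, G x • 𝓕 h x := by
      rw [SchwartzMap.fourier_coe]
      exact integral_fourier_smul_eq_of_integrable G.integrable h1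
    have i1 : Integrable fun x => g x • F x := by
      exact hFl.integrable_smul_left_of_hasCompactSupport g_smooth.continuous g_cpt
    have i2 : Integrable fun x => g x • 𝓕 h x := by
      exact hcl.integrable_smul_left_of_hasCompactSupport g_smooth.continuous g_cpt
    simp only [Pi.sub_apply, smul_sub]
    rw [integral_sub i1 i2, sub_eq_zero]
    have := e1.trans e2
    simpa [hGg] using this
  filter_upwards [key] with x hx
  exact sub_eq_zero.1 hx

theorem eLpNorm_fourier_eq {h : V → ℂ} (h1 : Integrable h) (h2 : MemLp h 2) :
    eLpNorm (𝓕 h) 2 volume = eLpNorm h 2 volume := by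
  rw [← eLpNorm_congr_ae (fourier_toLp_ae_eq h1 h2), ← eLpNorm_congr_ae h2.coeFn_toLp,
    ← Lp.enorm_def, ← Lp.enorm_def, enorm_eq_iff_norm_eq]
  exact Lp.norm_fourier_eq _

theorem ae_eq_zero_of_fourier_ae_eq_zero {h : V → ℂ} (h1 : Integrable h) (h2 : MemLp h 2)
    (h0 : 𝓕 h =ᵐ[volume] 0) : h =ᵐ[volume] 0 := by
  have := eLpNorm_fourier_eq h1 h2
  rw [eLpNorm_congr_ae h0, eLpNorm_zero] at this
  exact (eLpNorm_eq_zero_iff h1.1 (by norm_num)).1 this.symm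

/-- Differentiation under the integral: the bound on `k` where `h ≠ 0` dominates the derivative
uniformly for parameters in the unit ball around `z`. -/
theorem hasDerivAt_integral_exp_mul {h k : V → ℂ} {M : ℝ} (hh : Integrable h)
    (hk : AEStronglyMeasurable k volume) (hM : ∀ᵐ x, h x ≠ 0 → ‖k x‖ ≤ M) (z : ℂ) :
    HasDerivAt (fun z : ℂ => ∫ x, exp (z * k x) * h x)
      (∫ x, (exp (z * k x) * k x) * h x) z := by
  have meas : ∀ z : ℂ, AEStronglyMeasurable (fun x => exp (z * k x)) volume := fun z =>
    continuous_exp.comp_aestronglyMeasurable (hk.const_mul z)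
  have bnd : ∀ w x, ‖k x‖ ≤ M → ‖exp (w * k x)‖ ≤ Real.exp (‖w‖ * M) := fun w x hx => by
    refine (norm_exp_le_exp_norm _).trans (Real.exp_le_exp.2 ?_)
    rw [norm_mul]
    gcongr
  refine (hasDerivAt_integral_of_dominated_loc_of_deriv_le
    (F' := fun w x => (exp (w * k x) * k x) * h x)
    (bound := fun x => (Real.exp ((‖z‖ + 1) * |M|) * |M|) * ‖h x‖)
    (Metric.ball_mem_nhds z one_pos)
    (Filter.Eventually.of_forall fun w => (meas w).mul hh.1) ?_
    (((meas z).mul hk).mul hh.1) ?_ (hh.norm.const_mul _) ?_).2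
  · refine (hh.norm.const_mul (Real.exp (‖z‖ * M))).mono ((meas z).mul hh.1) ?_
    filter_upwards [hM] with x hx
    by_cases h0 : h x = 0
    · simp [h0]
    rw [Pi.mul_apply, norm_mul, norm_mul, norm_norm, Real.norm_eq_abs, Real.abs_exp]
    gcongr
    exact bnd z x (hx h0)
  · filter_upwards [hM] with x hx w hw
    by_cases h0 : h x = 0
    · simp [h0]
    rw [norm_mul, norm_mul]
    have hw' : ‖w‖ ≤ ‖z‖ + 1 := by
      have := norm_sub_norm_le w z
      rw [mem_ball_iff_norm] at hw
      linarith
    have hkx := (hx h0).trans (le_abs_self M)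
    gcongr
    refine (norm_exp_le_exp_norm _).trans (Real.exp_le_exp.2 ?_)
    rw [norm_mul]
    gcongr
  · refine Filter.Eventually.of_forall fun x w _ => ?_
    simpa using ((((hasDerivAt_id w).mul_const (k x)).cexp).mul_const (h x))

/-- The Fourier transform of a function with bounded support is analytic along lines. -/
theorem analyticOnNhd_fourier_line {h : V → ℂ} (hh : Integrable h) {M : ℝ}
    (hM : ∀ᵐ x, h x ≠ 0 → ‖x‖ ≤ M) (w e : V) :
    AnalyticOnNhd ℝ (fun t : ℝ => 𝓕 h (w + t • e)) Set.univ := by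
  -- The character at the base point `w` is absorbed into `g`; the remaining factor `exp (t * k x)`
  -- makes sense for complex `t`, giving an entire extension.
  set g : V → ℂ := fun x => Real.fourierChar (-inner ℝ x w) • h x with hg
  have hgi : Integrable g := (Real.fourierIntegral_convergent_iff w).2 hh
  set k : V → ℂ := fun x => ((-2 * Real.pi * inner ℝ x e : ℝ) : ℂ) * I with hk
  have hkc : Continuous k := by fun_prop
  have hkM : ∀ᵐ x, g x ≠ 0 → ‖k x‖ ≤ 2 * Real.pi * (M * ‖e‖) := by
    filter_upwards [hM] with x hx hgx
    have h0 : h x ≠ 0 := fun h0 => hgx (by simp [hg, h0])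
    have := (norm_inner_le_norm (𝕜 := ℝ) x e).trans
      (mul_le_mul_of_nonneg_right (hx h0) (norm_nonneg e))
    rw [hk]
    simp only [norm_mul, norm_I, mul_one, norm_real, norm_neg, Real.norm_ofNat,
      Real.norm_of_nonneg Real.pi_pos.le]
    gcongr
  have hd : Differentiable ℂ fun z : ℂ => ∫ x, exp (z * k x) * g x := fun z =>
    (hasDerivAt_integral_exp_mul hgi hkc.aestronglyMeasurable hkM z).differentiableAt
  intro t _
  have h1 : AnalyticAt ℝ (fun z : ℂ => ∫ x, exp (z * k x) * g x) (Complex.ofRealCLM t) :=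
    (hd.analyticAt _).restrictScalars
  have h2 := h1.comp (Complex.ofRealCLM.analyticAt t)
  convert! h2 using 1
  funext t
  rw [Real.fourier_eq, Function.comp_apply]
  refine integral_congr_ae (Filter.Eventually.of_forall fun x => ?_)
  simp only [hg, hk, Circle.smul_def, Real.fourierChar_apply, smul_eq_mul, ofRealCLM_apply]
  rw [← mul_assoc, ← exp_add, inner_add_right, inner_smul_right]
  congr 2
  push_cast
  ring

/-- Otherwise the zeros of `g` would be discrete, hence null, and `T` would be conull in `ℝ`,
contradicting finite measure. -/
theorem analyticOnNhd_eq_zero_of_ae_compl {g : ℝ → ℂ} (hg : AnalyticOnNhd ℝ g Set.univ)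
    {T : Set ℝ} (hT : volume T < ⊤) (h0 : ∀ᵐ t, t ∉ T → g t = 0) (t : ℝ) : g t = 0 := by
  rcases hg.eqOn_zero_or_eventually_ne_zero_of_preconnected isPreconnected_univ with h | h
  · exact h (Set.mem_univ t)
  · have h' := ae_restrict_le_codiscreteWithin (μ := volume) MeasurableSet.univ h
    rw [Measure.restrict_univ] at h'
    have : ∀ᵐ t, t ∈ T := by
      filter_upwards [h0, h'] with t h1 h2
      by_contra h3
      exact h2 (h1 h3)
    rw [measure_congr (show T =ᵐ[volume] Set.univ from Filter.eventuallyEq_univ.2 this)] at hT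
    simp at hT

end FourierAnalysis

/-! ### Fourier uniqueness on the plane, by slicing. -/

section PlaneFourier

open FourierTransform

theorem measurePreserving_plane_mk :
    MeasurePreserving (fun p : ℝ × ℝ => (!₂[p.1, p.2] : Plane)) volume volume :=
  (PiLp.volume_preserving_toLp (Fin 2)).comp (volume_preserving_finTwoArrow ℝ).symm

/-- A function on the plane with bounded support whose Fourier transform vanishes a.e. outside a
set of finite measure is zero. -/
theorem ae_eq_zero_of_fourier_supported {h : Plane → ℂ} (h1 : Integrable h) (h2 : MemLp h 2)
    {M : ℝ} (hM : ∀ᵐ x, h x ≠ 0 → ‖x‖ ≤ M) {T : Set Plane} (hT : volume T < ⊤)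
    (h0 : ∀ᵐ w, w ∉ T → 𝓕 h w = 0) : h =ᵐ[volume] 0 := by
  refine ae_eq_zero_of_fourier_ae_eq_zero h1 h2 ?_
  have mp := measurePreserving_plane_mk
  -- `T` need not be measurable; its measurable hull has the same measure.
  set T' := toMeasurable volume T
  set P : Set (ℝ × ℝ) := (fun p : ℝ × ℝ => (!₂[p.1, p.2] : Plane)) ⁻¹' T' with hP
  have hPm : MeasurableSet P := mp.measurable (measurableSet_toMeasurable _ _)
  have hPf : (volume : Measure (ℝ × ℝ)) P ≠ ⊤ := by
    rw [hP, mp.measure_preimage (measurableSet_toMeasurable _ _).nullMeasurableSet,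
      measure_toMeasurable]
    exact hT.ne
  have hp : ∀ᵐ p : ℝ × ℝ, p ∉ P → 𝓕 h !₂[p.1, p.2] = 0 := by
    filter_upwards [mp.quasiMeasurePreserving.ae h0] with p hp hpP
    exact hp fun hpT => hpP (subset_toMeasurable _ _ hpT)
  have hcont := continuous_fourier_of_integrable h1
  have hmk : Continuous fun p : ℝ × ℝ => (!₂[p.1, p.2] : Plane) := by fun_prop
  have hall : ∀ᵐ p : ℝ × ℝ, 𝓕 h !₂[p.1, p.2] = 0 := by
    rw [Measure.volume_eq_prod] at hp hPf ⊢
    rw [Measure.ae_prod_iff_ae_ae (p := fun p : ℝ × ℝ => 𝓕 h !₂[p.1, p.2] = 0)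
      (isClosed_eq (hcont.comp hmk) continuous_const).measurableSet]
    filter_upwards [Measure.ae_ae_of_ae_prod hp, Measure.ae_measure_lt_top hPm hPf] with s hs hs'
    refine Filter.Eventually.of_forall fun t => ?_
    have hline : ∀ t : ℝ, (!₂[s, t] : Plane) = !₂[s, 0] + t • !₂[0, 1] := fun t => by
      ext i; fin_cases i <;> simp
    have han := analyticOnNhd_fourier_line h1 hM !₂[s, 0] !₂[0, 1]
    simp only [← hline] at han
    exact analyticOnNhd_eq_zero_of_ae_compl han hs' hs t
  have hset : MeasurableSet {w : Plane | 𝓕 h w = 0} :=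
    (isClosed_eq hcont continuous_const).measurableSet
  have := mp.map_eq ▸ (ae_map_iff mp.measurable.aemeasurable hset).2 hall
  exact this

end PlaneFourier

/-! ### Reduction of the two-sided exponentials to complex phases. -/

section QuaternionSplitting

theorem quatI_re : quatI.re = 0 := rfl

theorem quatI_imI : quatI.imI = 1 := rfl

theorem quatI_imJ : quatI.imJ = 0 := rfl

theorem quatI_imK : quatI.imK = 0 := rfl

theorem quatJ_re : quatJ.re = 0 := rfl

theorem quatJ_imI : quatJ.imI = 0 := rfl

theorem quatJ_imJ : quatJ.imJ = 1 := rfl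

theorem quatJ_imK : quatJ.imK = 0 := rfl

theorem quatI_mul_self : quatI * quatI = -1 := by
  ext <;> simp only [Quaternion.re_mul, Quaternion.imI_mul, Quaternion.imJ_mul,
    Quaternion.imK_mul, quatI_re, quatI_imI, quatI_imJ, quatI_imK, Quaternion.re_neg,
    Quaternion.imI_neg, Quaternion.imJ_neg, Quaternion.imK_neg, Quaternion.re_one,
    Quaternion.imI_one, Quaternion.imJ_one, Quaternion.imK_one] <;> ring

theorem quatJ_mul_self : quatJ * quatJ = -1 := by
  ext <;> simp only [Quaternion.re_mul, Quaternion.imI_mul, Quaternion.imJ_mul,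
    Quaternion.imK_mul, quatJ_re, quatJ_imI, quatJ_imJ, quatJ_imK, Quaternion.re_neg,
    Quaternion.imI_neg, Quaternion.imJ_neg, Quaternion.imK_neg, Quaternion.re_one,
    Quaternion.imI_one, Quaternion.imJ_one, Quaternion.imK_one] <;> ring

/-- Euler's formula, transported along the algebra map `ℂ → ℍ` that sends `Complex.I` to `quatI`. -/
theorem expI_eq (t : ℝ) :
    expI t = algebraMap ℝ Quat (Real.cos t) + Real.sin t • quatI := by
  let _ : NormedAlgebra ℚ Quat := NormedAlgebra.restrictScalars ℚ ℝ Quat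
  let _ : NormedAlgebra ℚ ℂ := NormedAlgebra.restrictScalars ℚ ℝ ℂ
  let L : ℂ →ₐ[ℝ] Quat := Complex.lift ⟨quatI, quatI_mul_self⟩
  have hL : ∀ z : ℂ, L z = algebraMap ℝ Quat z.re + z.im • quatI := fun _ => rfl
  have hc : Continuous L := L.toLinearMap.continuous_of_finiteDimensional
  have h := NormedSpace.map_exp L hc (t * Complex.I)
  rw [← Complex.exp_eq_exp_ℂ, hL, hL, Complex.exp_ofReal_mul_I_re,
    Complex.exp_ofReal_mul_I_im] at h
  simpa [expI] using h.symm

theorem expJ_eq (t : ℝ) :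
    expJ t = algebraMap ℝ Quat (Real.cos t) + Real.sin t • quatJ := by
  let _ : NormedAlgebra ℚ Quat := NormedAlgebra.restrictScalars ℚ ℝ Quat
  let _ : NormedAlgebra ℚ ℂ := NormedAlgebra.restrictScalars ℚ ℝ ℂ
  let L : ℂ →ₐ[ℝ] Quat := Complex.lift ⟨quatJ, quatJ_mul_self⟩
  have hL : ∀ z : ℂ, L z = algebraMap ℝ Quat z.re + z.im • quatJ := fun _ => rfl
  have hc : Continuous L := L.toLinearMap.continuous_of_finiteDimensional
  have h := NormedSpace.map_exp L hc (t * Complex.I)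
  rw [← Complex.exp_eq_exp_ℂ, hL, hL, Complex.exp_ofReal_mul_I_re,
    Complex.exp_ofReal_mul_I_im] at h
  simpa [expJ] using h.symm

theorem expI_re (t : ℝ) : (expI t).re = Real.cos t := by
  simp [expI_eq, quatI_re, Quaternion.algebraMap_def]

theorem expI_imI (t : ℝ) : (expI t).imI = Real.sin t := by
  simp [expI_eq, quatI_imI, Quaternion.algebraMap_def]

theorem expI_imJ (t : ℝ) : (expI t).imJ = 0 := by
  simp [expI_eq, quatI_imJ, Quaternion.algebraMap_def]

theorem expI_imK (t : ℝ) : (expI t).imK = 0 := by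
  simp [expI_eq, quatI_imK, Quaternion.algebraMap_def]

theorem expJ_re (t : ℝ) : (expJ t).re = Real.cos t := by
  simp [expJ_eq, quatJ_re, Quaternion.algebraMap_def]

theorem expJ_imI (t : ℝ) : (expJ t).imI = 0 := by
  simp [expJ_eq, quatJ_imI, Quaternion.algebraMap_def]

theorem expJ_imJ (t : ℝ) : (expJ t).imJ = Real.sin t := by
  simp [expJ_eq, quatJ_imJ, Quaternion.algebraMap_def]

theorem expJ_imK (t : ℝ) : (expJ t).imK = 0 := by
  simp [expJ_eq, quatJ_imK, Quaternion.algebraMap_def]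

/-- The coordinate of a quaternion `q` in the plane `i q = -q j`. -/
noncomputable def splitMinus : Quat →L[ℝ] ℂ :=
  LinearMap.toContinuousLinearMap
    { toFun := fun q => ⟨q.re + q.imK, q.imI - q.imJ⟩
      map_add' := fun p q => by
        apply Complex.ext <;> simp <;> ring
      map_smul' := fun c q => by
        apply Complex.ext <;> simp <;> ring }

/-- The coordinate of a quaternion `q` in the plane `i q = q j`. -/
noncomputable def splitPlus : Quat →L[ℝ] ℂ :=
  LinearMap.toContinuousLinearMap
    { toFun := fun q => ⟨q.re - q.imK, q.imI + q.imJ⟩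
      map_add' := fun p q => by
        apply Complex.ext <;> simp <;> ring
      map_smul' := fun c q => by
        apply Complex.ext <;> simp <;> ring }

theorem splitMinus_apply (q : Quat) : splitMinus q = ⟨q.re + q.imK, q.imI - q.imJ⟩ := rfl

theorem splitPlus_apply (q : Quat) : splitPlus q = ⟨q.re - q.imK, q.imI + q.imJ⟩ := rfl

/-- On the plane `i q = -q j`, `q e^{jt} = e^{-it} q`, so the right exponential moves to the left
with its sign reversed. -/
theorem splitMinus_exp_mul_mul_exp (s t : ℝ) (q : Quat) :
    splitMinus (expI s * q * expJ t) =
      Complex.exp (((s - t : ℝ) : ℂ) * Complex.I) * splitMinus q := by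
  apply Complex.ext <;>
  simp only [Complex.mul_re, Complex.mul_im, Complex.exp_ofReal_mul_I_re,
    Complex.exp_ofReal_mul_I_im, Real.cos_sub, Real.sin_sub, splitMinus_apply, expI_re, expI_imI, expI_imJ, expI_imK,
    expJ_re, expJ_imI, expJ_imJ, expJ_imK,
    Quaternion.re_mul, Quaternion.imI_mul, Quaternion.imJ_mul, Quaternion.imK_mul] <;> ring

theorem splitPlus_exp_mul_mul_exp (s t : ℝ) (q : Quat) :
    splitPlus (expI s * q * expJ t) =
      Complex.exp (((s + t : ℝ) : ℂ) * Complex.I) * splitPlus q := by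
  apply Complex.ext <;>
  simp only [Complex.mul_re, Complex.mul_im, Complex.exp_ofReal_mul_I_re,
    Complex.exp_ofReal_mul_I_im, Real.cos_add, Real.sin_add, splitPlus_apply, expI_re, expI_imI, expI_imJ, expI_imK,
    expJ_re, expJ_imI, expJ_imJ, expJ_imK,
    Quaternion.re_mul, Quaternion.imI_mul, Quaternion.imJ_mul, Quaternion.imK_mul] <;> ring

/-- The two planes are orthogonal, and each coordinate stretches its plane by `√2`. -/
theorem norm_split_sq_add (q : Quat) :
    ‖splitMinus q‖ ^ 2 + ‖splitPlus q‖ ^ 2 = 2 * ‖q‖ ^ 2 := by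
  rw [Complex.sq_norm, Complex.sq_norm, sq ‖q‖, ← Quaternion.normSq_eq_norm_mul_self,
    Quaternion.normSq_def', Complex.normSq_apply, Complex.normSq_apply, splitMinus_apply,
    splitPlus_apply]
  ring

theorem enorm_split_sq_add (q : Quat) :
    ‖splitMinus q‖ₑ ^ 2 + ‖splitPlus q‖ₑ ^ 2 = 2 * ‖q‖ₑ ^ 2 := by
  have h : ‖splitMinus q‖₊ ^ 2 + ‖splitPlus q‖₊ ^ 2 = 2 * ‖q‖₊ ^ 2 :=
    NNReal.eq (by simpa using norm_split_sq_add q)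
  simp only [enorm_eq_nnnorm]
  exact_mod_cast h

/-- The reflection `(x₁, x₂) ↦ (x₁, -x₂)` of the plane. -/
noncomputable def planeReflection : Plane ≃ₗᵢ[ℝ] Plane :=
  LinearIsometryEquiv.piLpCongrRight 2 ![LinearIsometryEquiv.refl ℝ ℝ, LinearIsometryEquiv.neg ℝ]

end QuaternionSplitting

/-! ### Plancherel identity, annihilation and closed image for the GQFT. -/

section WindowedTransform

open FourierTransform

/-- The product of `f` with the conjugate of the window translated by `b`. -/
noncomputable def windowed (φ f : Plane → Quat) (b x : Plane) : Quat := f x * star (φ (x - b))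

theorem memLp_star_translate {φ : Plane → Quat} {p : ENNReal} (hφ : MemLp φ p) (b : Plane) :
    MemLp (fun x => star (φ (x - b))) p :=
  (hφ.comp_measurePreserving (measurePreserving_sub_right volume b)).star

theorem integrable_windowed (φ f : L2Plane) (b : Plane) : Integrable (windowed φ f b) :=
  (Lp.memLp f).integrable_mul (memLp_star_translate (Lp.memLp φ) b)

/-- The boundedness of the window enters here, making Plancherel available for every `b`. -/
theorem memLp_windowed {φ f : L2Plane} (hφ : MemLp φ ⊤ (volume : Measure Plane)) (b : Plane) :
    MemLp (windowed φ f b) 2 :=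
  (memLp_star_translate hφ b).mul (Lp.memLp f)

theorem windowed_support {φ : Plane → Quat} {r : ℝ}
    (hφ : ∀ᵐ x : Plane, x ∉ Metric.ball (0 : Plane) r → φ x = 0) (f : Plane → Quat) (b : Plane) :
    ∀ᵐ x, windowed φ f b x ≠ 0 → ‖x‖ ≤ r + ‖b‖ := by
  filter_upwards [(measurePreserving_sub_right volume b).quasiMeasurePreserving.ae hφ]
    with x hx h0
  by_contra hlt
  refine h0 ?_
  rw [windowed, hx fun hb => hlt ?_, star_zero, mul_zero]
  rw [mem_ball_zero_iff] at hb
  have := norm_le_norm_sub_add x b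
  linarith

theorem splitMinus_gqft (φ f : L2Plane) (ω b : Plane) :
    splitMinus (gqft φ f ω b) =
      𝓕 (fun x => splitMinus (windowed φ f b x)) (planeReflection ω) := by
  rw [gqft, ← ContinuousLinearMap.integral_comp_comm _ (integrable_gqft φ f ω b), Real.fourier_eq]
  refine integral_congr_ae (Filter.Eventually.of_forall fun x => ?_)
  simp only [splitMinus_exp_mul_mul_exp, Circle.smul_def, Real.fourierChar_apply, smul_eq_mul,
    windowed]
  congr 4
  simp [planeReflection, PiLp.inner_apply, Fin.sum_univ_two]
  ring

theorem splitPlus_gqft (φ f : L2Plane) (ω b : Plane) :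
    splitPlus (gqft φ f ω b) = 𝓕 (fun x => splitPlus (windowed φ f b x)) ω := by
  rw [gqft, ← ContinuousLinearMap.integral_comp_comm _ (integrable_gqft φ f ω b), Real.fourier_eq]
  refine integral_congr_ae (Filter.Eventually.of_forall fun x => ?_)
  simp only [splitPlus_exp_mul_mul_exp, Circle.smul_def, Real.fourierChar_apply, smul_eq_mul,
    windowed]
  congr 4
  simp [PiLp.inner_apply, Fin.sum_univ_two]
  ring

theorem lintegral_enorm_sq_eq_of_eLpNorm_eq {α E F : Type*} [MeasurableSpace α] {μ : Measure α}
    [NormedAddCommGroup E] [NormedAddCommGroup F] {g : α → E} {h : α → F}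
    (H : eLpNorm g 2 μ = eLpNorm h 2 μ) : ∫⁻ x, ‖g x‖ₑ ^ 2 ∂μ = ∫⁻ x, ‖h x‖ₑ ^ 2 ∂μ := by
  have e1 := eLpNorm_nnreal_pow_eq_lintegral (f := g) (μ := μ) (p := 2) two_ne_zero
  have e2 := eLpNorm_nnreal_pow_eq_lintegral (f := h) (μ := μ) (p := 2) two_ne_zero
  simp only [NNReal.coe_ofNat, ENNReal.rpow_ofNat, ENNReal.coe_ofNat] at e1 e2
  rw [← e1, ← e2, H]

theorem Lp_enorm_sq_eq_lintegral {α E : Type*} [MeasurableSpace α] {μ : Measure α}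
    [NormedAddCommGroup E] (g : Lp E 2 μ) : ‖g‖ₑ ^ 2 = ∫⁻ x, ‖g x‖ₑ ^ 2 ∂μ := by
  have e1 := eLpNorm_nnreal_pow_eq_lintegral (f := g) (μ := μ) (p := 2) two_ne_zero
  simp only [NNReal.coe_ofNat, ENNReal.rpow_ofNat, ENNReal.coe_ofNat] at e1
  rw [← e1, Lp.enorm_def]

/-- Scalar Plancherel on each plane, summed; the reflection of the frequency preserves measure. -/
theorem lintegral_enorm_sq_gqft {φ f : L2Plane} (hφ : MemLp φ ⊤ (volume : Measure Plane))
    (b : Plane) :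
    ∫⁻ ω, ‖gqft φ f ω b‖ₑ ^ 2 = ∫⁻ x, ‖windowed φ f b x‖ₑ ^ 2 := by
  have hw := integrable_windowed φ f b
  have hw2 := memLp_windowed (f := f) hφ b
  have im := splitMinus.integrable_comp hw
  have ip := splitPlus.integrable_comp hw
  have cm := continuous_fourier_of_integrable im
  have A := planeReflection.measurePreserving
  have em := lintegral_enorm_sq_eq_of_eLpNorm_eq (eLpNorm_fourier_eq im (splitMinus.comp_memLp' hw2))
  have ep := lintegral_enorm_sq_eq_of_eLpNorm_eq (eLpNorm_fourier_eq ip (splitPlus.comp_memLp' hw2))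
  rw [← A.lintegral_comp (by fun_prop)] at em
  rw [← ENNReal.mul_right_inj two_ne_zero ENNReal.ofNat_ne_top,
    ← lintegral_const_mul' _ _ ENNReal.ofNat_ne_top, ← lintegral_const_mul' _ _ ENNReal.ofNat_ne_top]
  simp only [← enorm_split_sq_add, splitMinus_gqft, splitPlus_gqft]
  have hA := planeReflection.continuous
  rw [lintegral_add_left' (by fun_prop), lintegral_add_left' (im.1.enorm.pow_const 2)]
  exact congrArg₂ _ em ep

/-- By Tonelli, integrate in `b` first: for each `x`, invariance of Lebesgue measure under `b ↦ x -
b` yields `‖φ‖²`. -/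
theorem lintegral_lintegral_enorm_sq_windowed (φ f : L2Plane) :
    ∫⁻ b, ∫⁻ x, ‖windowed φ f b x‖ₑ ^ 2 = ‖f‖ₑ ^ 2 * ‖φ‖ₑ ^ 2 := by
  have hf : AEMeasurable (fun x => ‖f x‖ₑ ^ 2) volume := (Lp.aestronglyMeasurable f).enorm.pow_const 2
  have hφ : AEMeasurable (fun x => ‖φ x‖ₑ ^ 2) volume := (Lp.aestronglyMeasurable φ).enorm.pow_const 2
  have h : ∀ b x, ‖windowed φ f b x‖ₑ ^ 2 = ‖f x‖ₑ ^ 2 * ‖φ (x - b)‖ₑ ^ 2 := fun b x => by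
    have h' : ‖windowed φ f b x‖₊ = ‖f x‖₊ * ‖φ (x - b)‖₊ := by
      rw [windowed, nnnorm_mul, nnnorm_star]
    simp only [enorm_eq_nnnorm, h', ENNReal.coe_mul, mul_pow]
  simp only [h]
  rw [lintegral_lintegral_swap]
  · have hx : ∀ x, ∫⁻ b, ‖f x‖ₑ ^ 2 * ‖φ (x - b)‖ₑ ^ 2 = ‖f x‖ₑ ^ 2 * ‖φ‖ₑ ^ 2 := fun x => by
      rw [lintegral_const_mul' _ _ (by simp), Lp_enorm_sq_eq_lintegral,
        lintegral_sub_left_eq_self (fun y => ‖φ y‖ₑ ^ 2)]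
    simp only [hx]
    rw [lintegral_mul_const' _ _ (by simp), Lp_enorm_sq_eq_lintegral f]
  · refine (hf.comp_quasiMeasurePreserving Measure.quasiMeasurePreserving_snd).mul ?_
    exact hφ.comp_quasiMeasurePreserving ((quasiMeasurePreserving_sub volume volume).comp
      Measure.measurePreserving_swap.quasiMeasurePreserving)

/-- The GQFT is `‖φ‖` times an isometry. -/
theorem norm_eq_of_ae_eq_gqft {φ f : L2Plane} (hφ : MemLp φ ⊤ (volume : Measure Plane))
    {F : L2Phase} (hF : ∀ᵐ p : Plane × Plane, F p = gqft φ f p.1 p.2) :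
    ‖F‖ = ‖f‖ * ‖φ‖ := by
  have hFm : AEMeasurable (fun p => ‖F p‖ₑ ^ 2) (volume.prod volume) :=
    (Lp.aestronglyMeasurable F).enorm.pow_const 2
  have hsw : ∀ᵐ b : Plane, ∀ᵐ ω : Plane, F (ω, b) = gqft φ f ω b :=
    Measure.ae_ae_of_ae_prod (Measure.measurePreserving_swap.quasiMeasurePreserving.ae hF)
  have : ‖F‖ₑ ^ 2 = (‖f‖ₑ * ‖φ‖ₑ) ^ 2 := by
    rw [mul_pow, ← lintegral_lintegral_enorm_sq_windowed, Lp_enorm_sq_eq_lintegral]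
    refine (lintegral_prod_symm _ hFm).trans ?_
    refine lintegral_congr_ae ?_
    filter_upwards [hsw] with b hb
    rw [← lintegral_enorm_sq_gqft hφ]
    refine lintegral_congr_ae ?_
    filter_upwards [hb] with ω hω
    rw [hω]
  have h2 : ‖F‖ ^ 2 = (‖f‖ * ‖φ‖) ^ 2 := by
    simp only [enorm_eq_nnnorm] at this
    exact congrArg NNReal.toReal (ENNReal.coe_injective (by exact_mod_cast this))
  exact (sq_eq_sq₀ (norm_nonneg _) (by positivity)).1 h2

theorem windowed_ae_eq_zero_of_gqft_supported {φ f : L2Plane}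
    (hφ : MemLp φ ⊤ (volume : Measure Plane)) {r : ℝ}
    (hφs : ∀ᵐ x : Plane, x ∉ Metric.ball (0 : Plane) r → φ x = 0) {b : Plane} {T : Set Plane}
    (hT : volume T < ⊤) (h : ∀ᵐ ω, ω ∉ T → gqft φ f ω b = 0) :
    windowed φ f b =ᵐ[volume] 0 := by
  have hw := integrable_windowed φ f b
  have hw2 := memLp_windowed (f := f) hφ b
  have hs := windowed_support hφs f b
  have A := planeReflection.measurePreserving
  have As := planeReflection.symm.measurePreserving
  have hm := ae_eq_zero_of_fourier_supported (splitMinus.integrable_comp hw)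
    (splitMinus.comp_memLp' hw2) (M := r + ‖b‖) (T := planeReflection.symm ⁻¹' T)
    (by
      filter_upwards [hs] with x hx h0
      exact hx fun hz => h0 (by rw [hz, map_zero]))
    (by
      have := As.measure_preimage_equiv (f := planeReflection.symm.toMeasurableEquiv) T
      exact this.trans_lt hT)
    (by
      filter_upwards [As.quasiMeasurePreserving.ae h] with w hw' hwT
      have := splitMinus_gqft φ f (planeReflection.symm w) b
      rw [hw' hwT, map_zero, LinearIsometryEquiv.apply_symm_apply] at this
      exact this.symm)
  have hp := ae_eq_zero_of_fourier_supported (splitPlus.integrable_comp hw)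
    (splitPlus.comp_memLp' hw2) (M := r + ‖b‖) (T := T)
    (by
      filter_upwards [hs] with x hx h0
      exact hx fun hz => h0 (by rw [hz, map_zero]))
    hT
    (by
      filter_upwards [h] with w hw' hwT
      rw [← splitPlus_gqft, hw' hwT, map_zero])
  filter_upwards [hm, hp] with x h1 h2
  have h3 := norm_split_sq_add (windowed φ f b x)
  have h1' : splitMinus (windowed φ f b x) = 0 := h1
  have h2' : splitPlus (windowed φ f b x) = 0 := h2
  rw [h1', h2', norm_zero] at h3
  have h4 : ‖windowed φ f b x‖ ^ 2 = 0 := by linarith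
  simpa using h4

/-- Sets of finite measure are weakly annihilating for bounded windows of bounded support. -/
theorem weaklyAnnihilating_of_measure_lt_top {φ : L2Plane}
    (hφ : MemLp φ ⊤ (volume : Measure Plane)) (hφ_ne : φ ≠ 0) {r : ℝ}
    (hφs : ∀ᵐ x : Plane, x ∉ Metric.ball (0 : Plane) r → φ x = 0) {A : Set (Plane × Plane)}
    (hA : volume A < ⊤) : WeaklyAnnihilating φ A := by
  intro f hf
  have swap := Measure.measurePreserving_swap (μ := (volume : Measure Plane))
    (ν := (volume : Measure Plane))
  -- The swap puts `b` first, so that slicing is at fixed `b`.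
  set B : Set (Plane × Plane) := Prod.swap ⁻¹' toMeasurable volume A with hB
  have hBm : MeasurableSet B := (measurableSet_toMeasurable _ _).preimage measurable_swap
  have hBf : (volume.prod volume : Measure (Plane × Plane)) B ≠ ⊤ := by
    rw [hB, swap.measure_preimage (measurableSet_toMeasurable _ _).nullMeasurableSet,
      ← Measure.volume_eq_prod, measure_toMeasurable]
    exact hA.ne
  have h1 : ∀ᵐ b : Plane, ∀ᵐ ω : Plane, (ω, b) ∉ A → gqft φ f ω b = 0 :=
    Measure.ae_ae_of_ae_prod (swap.quasiMeasurePreserving.ae hf)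
  have h2 : ∀ᵐ b, windowed φ f b =ᵐ[volume] 0 := by
    filter_upwards [h1, Measure.ae_measure_lt_top hBm hBf] with b hb hb'
    refine windowed_ae_eq_zero_of_gqft_supported hφ hφs hb' ?_
    filter_upwards [hb] with ω hω hωB
    exact hω fun hωA => hωB (subset_toMeasurable _ _ hωA)
  have h3 := lintegral_lintegral_enorm_sq_windowed φ f
  have h4 : ∫⁻ b, ∫⁻ x, ‖windowed φ f b x‖ₑ ^ 2 = 0 := by
    refine lintegral_eq_zero_of_ae_eq_zero ?_
    filter_upwards [h2] with b hb
    refine lintegral_eq_zero_of_ae_eq_zero ?_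
    filter_upwards [hb] with x hx
    simp [hx]
  rw [h4] at h3
  simpa [hφ_ne] using h3.symm

/-- Cauchy–Schwarz, since the exponentials have norm one. It makes evaluation at `(ω, b)` continuous
in `f`. -/
theorem enorm_gqft_le (φ f : L2Plane) (ω b : Plane) : ‖gqft φ f ω b‖ₑ ≤ ‖f‖ₑ * ‖φ‖ₑ := by
  have h1 : ‖gqft φ f ω b‖ₑ ≤ eLpNorm (windowed φ f b) 1 volume := by
    rw [eLpNorm_one_eq_lintegral_enorm]
    refine (enorm_integral_le_lintegral_enorm _).trans_eq (lintegral_congr fun x => ?_)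
    rw [enorm_eq_iff_norm_eq]
    simp [norm_expI, norm_expJ, windowed]
  have hs := memLp_star_translate (Lp.memLp φ) b
  refine h1.trans ((eLpNorm_smul_le_mul_eLpNorm (p := 2) (q := 2) hs.1
    (Lp.aestronglyMeasurable f)).trans_eq ?_)
  rw [Lp.enorm_def, Lp.enorm_def]
  congr 1
  rw [← eLpNorm_comp_measurePreserving (Lp.aestronglyMeasurable φ)
    (measurePreserving_sub_right volume b)]
  refine eLpNorm_congr_norm_ae (Filter.Eventually.of_forall fun x => ?_)
  simp

theorem norm_gqft_le (φ f : L2Plane) (ω b : Plane) : ‖gqft φ f ω b‖ ≤ ‖f‖ * ‖φ‖ := by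
  have := enorm_gqft_le φ f ω b
  simp only [enorm_eq_nnnorm] at this
  exact_mod_cast this

/-- The GQFT at `(ω, b)` as a continuous linear map. -/
noncomputable def gqftCLM (φ : L2Plane) (ω b : Plane) : L2Plane →L[ℝ] Quat :=
  LinearMap.mkContinuous
    { toFun := fun f => gqft φ f ω b
      map_add' := fun f g => gqft_add φ f g ω b
      map_smul' := fun c f => gqft_smul φ c f ω b } ‖φ‖
    fun f => (norm_gqft_le φ f ω b).trans_eq (mul_comm _ _)

/-- The norm identity pulls a convergent sequence of transforms back to a Cauchy sequence with some
limit `g`. The limit transform is that of `g`: compare a.e. convergence along a subsequence with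
pointwise continuity of `gqftCLM`. -/
theorem isClosed_gqftImage {φ : L2Plane} (hφ : MemLp φ ⊤ (volume : Measure Plane))
    (hφ_ne : φ ≠ 0) : IsClosed (gqftImage φ : Set L2Phase) := by
  refine isClosed_of_closure_subset fun F hF => ?_
  obtain ⟨G, hG, hGF⟩ := mem_closure_iff_seq_limit.1 hF
  choose f hf using hG
  have hpos : 0 < ‖φ‖ := norm_pos_iff.2 hφ_ne
  have hdist : ∀ m n, dist (f m) (f n) * ‖φ‖ = dist (G m) (G n) := fun m n => by
    rw [dist_eq_norm, dist_eq_norm]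
    refine (norm_eq_of_ae_eq_gqft hφ ?_).symm
    filter_upwards [Lp.coeFn_sub (G m) (G n), hf m, hf n] with p h1 h2 h3
    rw [h1, Pi.sub_apply, h2, h3]
    exact ((gqftCLM φ p.1 p.2).map_sub (f m) (f n)).symm
  have hc : CauchySeq f := by
    rw [Metric.cauchySeq_iff]
    intro ε hε
    obtain ⟨N, hN⟩ := Metric.cauchySeq_iff.1 hGF.cauchySeq (ε * ‖φ‖) (by positivity)
    refine ⟨N, fun m hm n hn => ?_⟩
    have := hN m hm n hn
    rw [← hdist] at this
    exact lt_of_mul_lt_mul_right this hpos.le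
  obtain ⟨g, hg⟩ := cauchySeq_tendsto_of_complete hc
  refine ⟨g, ?_⟩
  obtain ⟨ns, hns, hlim⟩ := (tendstoInMeasure_of_tendsto_Lp hGF).exists_seq_tendsto_ae
  filter_upwards [hlim, ae_all_iff.2 hf] with p hp hfp
  refine tendsto_nhds_unique hp ?_
  simp only [hfp]
  exact (((gqftCLM φ p.1 p.2).continuous.tendsto g).comp hg).comp hns.tendsto_atTop

theorem ae_eq_zero_of_mem_range_projSet {A : Set (Plane × Plane)} {hA : NullMeasurableSet A volume}
    {F : L2Phase} (hF : F ∈ LinearMap.range (projSet A hA)) :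
    ∀ᵐ p : Plane × Plane, p ∉ A → F p = 0 := by
  obtain ⟨G, rfl⟩ := hF
  have h : (projSet A hA G : Plane × Plane → Quat) =ᵐ[volume] A.indicator G :=
    MemLp.coeFn_toLp ((Lp.memLp G).mono ((Lp.aestronglyMeasurable G).indicator₀ hA)
      (Filter.Eventually.of_forall fun p => norm_indicator_le_norm_self G p))
  filter_upwards [h] with p hp hpA
  rw [hp, Set.indicator_of_notMem hpA]

end WindowedTransform

/-! ### The Benedicks-type theorem. -/

theorem mainTheorem1 (r R : ℝ) (hr : 0 < r) (hR : 0 < R)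
    (φ : L2Plane) (hφ_bdd : MemLp φ ⊤ (volume : Measure Plane)) (hφ_ne : φ ≠ 0)
    (hφ_supp : ∀ᵐ x : Plane, x ∉ Metric.ball (0 : Plane) r → φ x = 0)
    (S : Set Plane) (A : Set (Plane × Plane)) (hA_eq : A = S ×ˢ Metric.ball (0 : Plane) R)
    (hA : NullMeasurableSet A volume) (hA_pos : 0 < volume A) (hA_fin : volume A < ⊤) :
    LinearMap.range (projWindow φ : L2Phase →ₗ[ℝ] L2Phase) ⊓
        LinearMap.range (projSet A hA) = ⊥ ∧
      WeaklyAnnihilating φ A := by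
  have hwa := weaklyAnnihilating_of_measure_lt_top hφ_bdd hφ_ne hφ_supp hA_fin
  refine ⟨(Submodule.eq_bot_iff _).2 fun F hF => ?_, hwa⟩
  obtain ⟨hF1, hF2⟩ := hF
  have hF3 : F ∈ gqftImage φ := by
    have h : F ∈ (gqftImage φ).topologicalClosure :=
      (Submodule.range_starProjection (gqftImage φ).topologicalClosure).le hF1
    rwa [(isClosed_gqftImage hφ_bdd hφ_ne).submodule_topologicalClosure_eq] at h
  obtain ⟨f, hf⟩ := hF3
  have hf0 : f = 0 := hwa f <| by
    filter_upwards [hf, ae_eq_zero_of_mem_range_projSet hF2] with p h1 h2 hp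
    rw [← h1, h2 hp]
  have := norm_eq_of_ae_eq_gqft hφ_bdd hf
  rwa [hf0, norm_zero, zero_mul, norm_eq_zero] at this
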